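/- Let $n$ be a nonnegative integer, $\mathcal J=\mathcal J_n=\begin{bmatrix}0&I_n\\-I_n&0\end{bmatrix}$ and $A^H$ the conjugate transpose of $A$. Call $\mathcal S\in\mathbb C^{2n\times 2n}$ symplectic if $\mathcal S\mathcal J\mathcal S^H=\mathcal J$, and $\mathcal H$ Hamiltonian if $\mathcal H\mathcal J=(\mathcal H\mathcal J)^H$. Let $\mathcal S_1,\mathcal S_2\in\mathbb C^{2n\times 2n}$ be symplectic and let $X_1=\begin{bmatrix}X_{11}^1&X_{12}^1\\X_{21}^1&X_{22}^1\end{bmatrix}\in\mathbb C^{2n\times 2n}$ be Hermitian with $n\times n$ blocks. Put $$\mathcal M_1=\begin{bmatrix}X_{12}^1&0\\X_{22}^1&I\end{bmatrix}\mathcal S_2,\qquad \mathcal L_1=\begin{bmatrix}I&X_{11}^1\\0&X_{21}^1\end{bmatrix}\mathcal S_1,$$ and suppose that the pair $(\mathcal M_1,\mathcal L_1)$ is regular ($\det(\mathcal M_1-\lambda\mathcal L_1)\neq0$ for some $\lambda\in\mathbb C$) with ${\rm ind}_\infty(\mathcal M_1,\mathcal L_1)\le 1$ (the nilpotent block belonging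 to the eigenvalue $\infty$ in its Kronecker canonical form is absent or zero). Let $\hat n+\ell=n$, let $\mathbf U=[U_1\,|\,U_0,U_\infty]$ with $U_1\in\mathbb C^{2n\times2\hat n}$, $U_0,U_\infty\in\mathbb C^{2n\times\ell}$, let $\widehat{\mathcal S}\in\mathbb C^{2\hat n\times2\hat n}$ be symplectic, and let $\widehat{\mathcal H}\in\mathbb C^{2\hat n\times2\hat n}$ be Hamiltonian, such that $$\mathbf U^H\mathcal J_n\mathbf U=\mathcal J_{\hat n}\oplus\mathcal J_\ell,\quad \mathcal M_1U_0=0,\quad \mathcal L_1U_\infty=0,\quad \mathcal M_1U_1=\mathcal L_1U_1\widehat{\mathcal S},\quad e^{\widehat{\mathcal H}}=\widehat{\mathcal S},$$ and let $\mathcal H=\mathbf U(\widehat{\mathcal H}\oplus 0)(\mathcal J_{\hat n}\oplus\mathcal J_\ell)^H\mathbf U^H\mathcal J$, a Hamiltonian matrix. Write $$\mathcal S_2\mathcal H\mathcal S_2^{-1}=\begin{bmatrix}A&S\\D&-A^H\end{bmatrix},\qquad \mathcal S_1\mathcal H\mathcal S_1^{-1}=\begin{bmatrix}A_\star&S_\star\\D_\star&-A_\star^H\end{bmatrix},$$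 and let $Q,P,Q_\star,P_\star:\mathbb R\to\mathbb C^{n\times n}$ be given by the solutions of the linear initial value problems $$\frac{d}{dt}\begin{bmatrix}Q\\P\end{bmatrix}=\begin{bmatrix}-A&S\\D&A^H\end{bmatrix}\begin{bmatrix}Q\\P\end{bmatrix},\ \begin{bmatrix}Q(0)\\P(0)\end{bmatrix}=\begin{bmatrix}I\\X_{22}^1\end{bmatrix},\qquad \frac{d}{dt}\begin{bmatrix}Q_\star\\P_\star\end{bmatrix}=\begin{bmatrix}-A_\star^H&-D_\star\\-S_\star&A_\star\end{bmatrix}\begin{bmatrix}Q_\star\\P_\star\end{bmatrix},\ \begin{bmatrix}Q_\star(0)\\P_\star(0)\end{bmatrix}=\begin{bmatrix}I\\X_{11}^1\end{bmatrix}.$$ Then $$\{t\in\mathbb R\mid\det Q(t)\neq0\}=\{t\in\mathbb R\mid\det Q_\star(t)\neq0\}.$$ Moreover, if $\hat t\in\mathbb R$ is such that $\det Q(\hat t)=0$, then, with $\|\cdot\|$ the spectral norm and limits taken over $t\neq\hat t$, $$\lim_{t\to\hat t}\|P(t)Q(t)^{-1}\|=\lim_{t\to\hat t}\|X_{12}^1Q(t)^{-1}\|=\infty,\qquad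 \lim_{t\to\hat t}\|P_\star(t)Q_\star(t)^{-1}\|=\lim_{t\to\hat t}\|X_{21}^1Q_\star(t)^{-1}\|=\infty.$$ -/

import Mathlib

open scoped Matrix Topology Matrix.Norms.L2Operator

namespace SPFlow

/-- The index set of `2k` rows or columns, split into two halves of size `k`. -/
abbrev Dbl (k : ℕ) : Type := Fin k ⊕ Fin k

/-- The matrix `𝒥ₖ = [0, I; -I, 0]`. (Mathlib's `Matrix.J` has the opposite sign.) -/
def J (k : ℕ) : Matrix (Dbl k) (Dbl k) ℂ :=
  Matrix.fromBlocks 0 1 (-1) 0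

/-- `H` is Hamiltonian: `H𝒥 = (H𝒥)ᴴ`. -/
def IsHamiltonian {k : ℕ} (H : Matrix (Dbl k) (Dbl k) ℂ) : Prop :=
  H * J k = (H * J k)ᴴ

/-- `S` is (conjugate) symplectic: `S𝒥Sᴴ = 𝒥`. -/
def IsSymplectic {k : ℕ} (S : Matrix (Dbl k) (Dbl k) ℂ) : Prop :=
  S * J k * Sᴴ = J k

/-- The first member `[X₁₂, 0; X₂₂, I] S₂` of the pair `T_{S₁,S₂}(X)`. -/
def pairM {n : ℕ} (S₂ X : Matrix (Dbl n) (Dbl n) ℂ) : Matrix (Dbl n) (Dbl n) ℂ :=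
  Matrix.fromBlocks X.toBlocks₁₂ 0 X.toBlocks₂₂ 1 * S₂

/-- The second member `[I, X₁₁; 0, X₂₁] S₁` of the pair `T_{S₁,S₂}(X)`. -/
def pairL {n : ℕ} (S₁ X : Matrix (Dbl n) (Dbl n) ℂ) : Matrix (Dbl n) (Dbl n) ℂ :=
  Matrix.fromBlocks 1 X.toBlocks₁₁ 0 X.toBlocks₂₁ * S₁

/-- The pair `(A, B)` is regular: `det (A - λB) ≠ 0` for some `λ`. -/
def IsRegularPair {ι : Type*} [Fintype ι] [DecidableEq ι] (A B : Matrix ι ι ℂ) : Prop :=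
  ∃ z : ℂ, (A - z • B).det ≠ 0

/-- The index at infinity of the pair `(A, B)` is at most `ν`: there are invertible `P, R` with
`PAR = K ⊕ I`, `PBR = I ⊕ N` and `N` nilpotent with `N ^ ν = 0`.
(Bringing `K` and `N` to Jordan form changes neither this shape nor `N ^ ν = 0`.
For `ν = 0` the condition `N ^ 0 = 0` says that the block `N` is absent, i.e. `B` is invertible;
for `ν = 1` it says that `N` is absent or zero.) -/
def IndexAtInftyLE {ι : Type*} [Fintype ι] [DecidableEq ι] (A B : Matrix ι ι ℂ) (ν : ℕ) : Prop :=
  ∃ (p q : ℕ) (e : ι ≃ Fin p ⊕ Fin q) (P R : Matrix ι ι ℂ)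
    (K : Matrix (Fin p) (Fin p) ℂ) (N : Matrix (Fin q) (Fin q) ℂ),
    IsUnit P ∧ IsUnit R ∧
    P * A * R = (Matrix.fromBlocks K 0 0 1).submatrix e e ∧
    P * B * R = (Matrix.fromBlocks 1 0 0 N).submatrix e e ∧
    IsNilpotent N ∧ N ^ ν = 0

/-- The matrix `𝐔 = [U₁ | U₀, U_∞]`. -/
def bigU {n m l : ℕ} (U₁ : Matrix (Dbl n) (Dbl m) ℂ) (U₀ Uinf : Matrix (Dbl n) (Fin l) ℂ) :
    Matrix (Dbl n) (Dbl m ⊕ Dbl l) ℂ :=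
  Matrix.fromCols U₁ (Matrix.fromCols U₀ Uinf)

/-- The matrix `𝒥ₘ ⊕ 𝒥ₗ`. -/
def bigJ (m l : ℕ) : Matrix (Dbl m ⊕ Dbl l) (Dbl m ⊕ Dbl l) ℂ :=
  Matrix.fromBlocks (J m) 0 0 (J l)

/-- `(U₁, U₀, U_∞, Ŝ, Ĥ)` is an admissible choice of spectral data for the pair `(M, L)`, with
`n̂ = m` and `ℓ = l`: the columns of `U₀`, `U_∞`, `U₁` span the deflating subspaces for the zero,
the infinite and the finite nonzero eigenvalues, normalized by `𝐔ᴴ𝒥𝐔 = 𝒥ₘ ⊕ 𝒥ₗ`, and `Ĥ` is a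
Hamiltonian logarithm of the symplectic matrix `Ŝ`. -/
structure IsSpectralData {n m l : ℕ} (M L : Matrix (Dbl n) (Dbl n) ℂ)
    (U₁ : Matrix (Dbl n) (Dbl m) ℂ) (U₀ Uinf : Matrix (Dbl n) (Fin l) ℂ)
    (Shat Hhat : Matrix (Dbl m) (Dbl m) ℂ) : Prop where
  size : m + l = n
  normalized : (bigU U₁ U₀ Uinf)ᴴ * J n * bigU U₁ U₀ Uinf = bigJ m l
  zero_eig : M * U₀ = 0
  infty_eig : L * Uinf = 0
  finite_eig : M * U₁ = L * U₁ * Shat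
  symplectic : IsSymplectic Shat
  hamiltonian : IsHamiltonian Hhat
  exp_eq : NormedSpace.exp Hhat = Shat

/-- The matrix `ℋ = 𝐔 (Ĥ ⊕ 0) (𝒥ₘ ⊕ 𝒥ₗ)ᴴ 𝐔ᴴ 𝒥`. -/
def hamiltonianOf {n m l : ℕ} (U₁ : Matrix (Dbl n) (Dbl m) ℂ) (U₀ Uinf : Matrix (Dbl n) (Fin l) ℂ)
    (Hhat : Matrix (Dbl m) (Dbl m) ℂ) : Matrix (Dbl n) (Dbl n) ℂ :=
  bigU U₁ U₀ Uinf * Matrix.fromBlocks Hhat 0 0 (0 : Matrix (Dbl l) (Dbl l) ℂ) * (bigJ m l)ᴴ *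
    (bigU U₁ U₀ Uinf)ᴴ * J n

/-- For a Hamiltonian matrix `G = [A, S; D, -Aᴴ]`, the coefficient matrix `[-A, S; D, Aᴴ]` of the
linear system of the Riccati equation `W' = -WSW + WA + AᴴW + D`. -/
def coeff {n : ℕ} (G : Matrix (Dbl n) (Dbl n) ℂ) : Matrix (Dbl n) (Dbl n) ℂ :=
  Matrix.fromBlocks (-G.toBlocks₁₁) G.toBlocks₁₂ G.toBlocks₂₁ (G.toBlocks₁₁)ᴴ

/-- For a Hamiltonian matrix `G = [A, S; D, -Aᴴ]`, the coefficient matrix `[-Aᴴ, -D; -S, A]` of the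
linear system of the dual Riccati equation `W' = WDW + WAᴴ + AW - S`. -/
def coeffStar {n : ℕ} (G : Matrix (Dbl n) (Dbl n) ℂ) : Matrix (Dbl n) (Dbl n) ℂ :=
  Matrix.fromBlocks (-(G.toBlocks₁₁)ᴴ) (-G.toBlocks₂₁) (-G.toBlocks₁₂) G.toBlocks₁₁

/-- `Y(t) = [Q(t); P(t)]` is the solution on `ℝ` of `Y' = C Y`, `Y(0) = [I; W₀]`. -/
structure IsLinearSolution {n : ℕ} (C : Matrix (Dbl n) (Dbl n) ℂ) (W₀ : Matrix (Fin n) (Fin n) ℂ)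
    (Q P : ℝ → Matrix (Fin n) (Fin n) ℂ) : Prop where
  init : Matrix.fromRows (Q 0) (P 0) = Matrix.fromRows 1 W₀
  ode : ∀ t : ℝ, HasDerivAt (fun s : ℝ => Matrix.fromRows (Q s) (P s))
    (C * Matrix.fromRows (Q t) (P t)) t

end SPFlow

/-!
The linear relation `{(x, y) | M₁ x = L₁ y}` is parametrized by `(a, d)`, where `a` is the first half
of `S₂ x` and `d` the second half of `S₁ y`; explicitly `S₂ x = A₂ (a, d)` and `S₁ y = A₁ (a, d)` with
the frames `A₂ = [I, 0; -X₂₂, X₂₁]` and `A₁ = [X₁₂, -X₁₁; 0, I]` (`frameM`, `frameL`). The spectral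
data give a second parametrization: `x = U D₀ z` and `y = U D₁ z`, where `D₀ = I ⊕ I ⊕ 0` and
`D₁ = Ŝ ⊕ 0 ⊕ I` commute with `Ĥ ⊕ 0`. Comparing both yields a single matrix `κ` with
`S₂ ℋ S₂⁻¹ A₂ = A₂ κ` and `S₁ ℋ S₁⁻¹ A₁ = A₁ κ`, and `κ` kills the kernels of both frames, since
`Ĥ ⊕ 0` factors through `D₀` and through `D₁` (`IsSpectralData.exists_generator`).

Solving the initial value problems in these frames shows that `Q(t)` is the leading block of
`exp (-tκ)` and `Q⋆(t)` the trailing block of `exp (tκ)` (`IsLinearSolution.eq_toBlocks_exp`,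
`IsLinearSolution.eq_toBlocks_exp_star`). The two exponentials are inverse to each other, so the
complementary minor identity `det_mul_det_toBlocks₁₁` gives `det Q⋆ = det (exp (tκ)) det Q`.

If `Q(t̂) v = 0` with `v ≠ 0`, then `P(t̂) v = 0` or `X₁₂ v = 0` would place a point of the orbit of
`(v, 0)` in the kernel of a frame; `κ` vanishes there, so the orbit is constant and
`Q(t̂) v = v`, which is absurd. Hence `P(t̂) v` and `X₁₂ v` are nonzero while `Q(t) v → 0`, and as
`det Q` is analytic with `det Q(0) = 1`, `Q(t)` is invertible near `t̂`, so the norms blow up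
(`blowup`, `tendsto_norm_mul_inv_atTop`). The dual statement follows by exchanging the two halves.
-/

namespace SPFlow

open Matrix

/-! ### The symplectic group and Hamiltonian matrices -/

lemma J_mul_J (k : ℕ) : J k * J k = -1 := by
  simp [J, fromBlocks_multiply, ← fromBlocks_one, fromBlocks_neg]

lemma J_conjTranspose (k : ℕ) : (J k)ᴴ = -J k := by
  simp [J, fromBlocks_conjTranspose, fromBlocks_neg]

lemma bigJ_conjTranspose (m l : ℕ) : (bigJ m l)ᴴ = -bigJ m l := by
  simp [bigJ, fromBlocks_conjTranspose, fromBlocks_neg, J_conjTranspose]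

lemma bigJ_conjTranspose_mul (m l : ℕ) : (bigJ m l)ᴴ * bigJ m l = 1 := by
  rw [bigJ_conjTranspose, bigJ]
  simp [fromBlocks_multiply, fromBlocks_neg, J_mul_J]

lemma IsSymplectic.mul_J_conjTranspose_J {k : ℕ} {S : Matrix (Dbl k) (Dbl k) ℂ}
    (hS : IsSymplectic S) : S * (-(J k * Sᴴ * J k)) = 1 := by
  have h : S * J k * Sᴴ = J k := hS
  calc S * (-(J k * Sᴴ * J k)) = -(S * J k * Sᴴ * J k) := by
        simp only [mul_neg, Matrix.mul_assoc]
    _ = 1 := by rw [h, J_mul_J, neg_neg]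

lemma IsSymplectic.mul_inv {k : ℕ} {S : Matrix (Dbl k) (Dbl k) ℂ}
    (hS : IsSymplectic S) : S * S⁻¹ = 1 := by
  rw [inv_eq_right_inv hS.mul_J_conjTranspose_J, hS.mul_J_conjTranspose_J]

lemma IsSymplectic.inv_mul {k : ℕ} {S : Matrix (Dbl k) (Dbl k) ℂ}
    (hS : IsSymplectic S) : S⁻¹ * S = 1 :=
  mul_eq_one_comm.mp hS.mul_inv

/-- Symplectic similarities preserve the Hamiltonian structure. -/
lemma IsHamiltonian.conj {k : ℕ} {S H : Matrix (Dbl k) (Dbl k) ℂ}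
    (hH : IsHamiltonian H) (hS : IsSymplectic S) : IsHamiltonian (S * H * S⁻¹) := by
  have e : S * H * S⁻¹ * J k = S * (H * J k) * Sᴴ := by
    rw [inv_eq_right_inv hS.mul_J_conjTranspose_J]
    simp only [mul_neg, neg_mul, Matrix.mul_assoc, J_mul_J, mul_one, neg_neg]
  have hH' : (H * J k)ᴴ = H * J k := hH.symm
  rw [IsHamiltonian, e, conjTranspose_mul, conjTranspose_mul, conjTranspose_conjTranspose, hH',
    Matrix.mul_assoc]

/-- The lower right block of a Hamiltonian matrix `[A, S; D, ∗]` is `-Aᴴ`. -/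
lemma IsHamiltonian.toBlocks₁₁_conjTranspose {k : ℕ} {G : Matrix (Dbl k) (Dbl k) ℂ}
    (hG : IsHamiltonian G) : (G.toBlocks₁₁)ᴴ = -G.toBlocks₂₂ := by
  have h : G * J k = (G * J k)ᴴ := hG
  rw [← fromBlocks_toBlocks G, J, fromBlocks_multiply, fromBlocks_conjTranspose,
    fromBlocks_inj] at h
  simpa using h.2.2.1.symm

lemma isHamiltonian_hamiltonianOf {n m l : ℕ} (U₁ : Matrix (Dbl n) (Dbl m) ℂ)
    (U₀ Uinf : Matrix (Dbl n) (Fin l) ℂ) {Hhat : Matrix (Dbl m) (Dbl m) ℂ}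
    (hH : IsHamiltonian Hhat) : IsHamiltonian (hamiltonianOf U₁ U₀ Uinf Hhat) := by
  have hH' : (Hhat * J m)ᴴ = Hhat * J m := hH.symm
  have e : hamiltonianOf U₁ U₀ Uinf Hhat * J n =
      bigU U₁ U₀ Uinf * (fromBlocks (Hhat * J m) 0 0 0 : Matrix (Dbl m ⊕ Dbl l) (Dbl m ⊕ Dbl l) ℂ) *
        (bigU U₁ U₀ Uinf)ᴴ := by
    rw [hamiltonianOf, Matrix.mul_assoc _ (J n) (J n), J_mul_J,
      Matrix.mul_assoc (bigU U₁ U₀ Uinf) _ (bigJ m l)ᴴ]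
    simp [bigJ, fromBlocks_conjTranspose, fromBlocks_multiply, J_conjTranspose]
    rw [← Matrix.neg_mul, ← Matrix.mul_neg, fromBlocks_neg]
    simp
  rw [IsHamiltonian, e, conjTranspose_mul, conjTranspose_mul, conjTranspose_conjTranspose,
    fromBlocks_conjTranspose, hH', Matrix.mul_assoc]
  simp

/-! ### Reduction to a single linear flow -/

/-- The frame `[I, 0; -X₂₂, X₂₁]`: with `frameL X` it parametrizes the linear relation
`{(x, y) | M x = L y}` of the pair `(M, L)` by the first half of `S₂ x` and the second half
of `S₁ y`. -/
def frameM {n : ℕ} (X : Matrix (Dbl n) (Dbl n) ℂ) : Matrix (Dbl n) (Dbl n) ℂ :=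
  fromBlocks 1 0 (-X.toBlocks₂₂) X.toBlocks₂₁

/-- The frame `[X₁₂, -X₁₁; 0, I]`, the companion of `frameM X`. -/
def frameL {n : ℕ} (X : Matrix (Dbl n) (Dbl n) ℂ) : Matrix (Dbl n) (Dbl n) ℂ :=
  fromBlocks X.toBlocks₁₂ (-X.toBlocks₁₁) 0 1

/-- A solution of `M x = L y`, with `E = S₂ x` and `F = S₁ y`, is determined by the first half of `E`
and the second half of `F`. -/
lemma eq_frame_mul {n : ℕ} {ι : Type*} (X : Matrix (Dbl n) (Dbl n) ℂ)
    {E F : Matrix (Dbl n) ι ℂ}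
    (h : (fromBlocks X.toBlocks₁₂ 0 X.toBlocks₂₂ 1 : Matrix (Dbl n) (Dbl n) ℂ) * E =
      (fromBlocks 1 X.toBlocks₁₁ 0 X.toBlocks₂₁ : Matrix (Dbl n) (Dbl n) ℂ) * F) :
    E = frameM X * fromRows E.toRows₁ F.toRows₂ ∧ F = frameL X * fromRows E.toRows₁ F.toRows₂ := by
  rw [← fromRows_toRows E, ← fromRows_toRows F, fromBlocks_mul_fromRows,
    fromBlocks_mul_fromRows, fromRows_ext_iff] at h
  obtain ⟨h1, h2⟩ := h
  simp only [Matrix.zero_mul, Matrix.one_mul, add_zero, zero_add] at h1 h2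
  rw [frameM, frameL, fromBlocks_mul_fromRows, fromBlocks_mul_fromRows]
  constructor
  · conv_lhs => rw [← fromRows_toRows E]
    rw [fromRows_ext_iff, Matrix.neg_mul, ← h2]
    simp
  · conv_lhs => rw [← fromRows_toRows F]
    rw [fromRows_ext_iff, Matrix.neg_mul, h1]
    simp

/-- Abstract form of the reduction. In the coordinates `U`, the pair `(M, L)` satisfies
`M U D₀ = L U D₁`, and the generator `K` of the flow commutes with `D₀` and `D₁`. Then `K` becomes,
in the coordinates of the frames, a single matrix `κ` which represents both similarity
transforms of `ℋ = U K V`. -/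
lemma exists_generator_of_intertwining {n : ℕ} {ι : Type*} [Fintype ι] [DecidableEq ι]
    (e : Dbl n ≃ ι) (X S₁ S₂ : Matrix (Dbl n) (Dbl n) ℂ) (hS₁ : S₁⁻¹ * S₁ = 1)
    (hS₂ : S₂⁻¹ * S₂ = 1) (U : Matrix (Dbl n) ι ℂ) (V : Matrix ι (Dbl n) ℂ) (hVU : V * U = 1)
    (D₀ D₁ K N₀ N₁ K₀ K₁ : Matrix ι ι ℂ)
    (hML : pairM S₂ X * (U * D₀) = pairL S₁ X * (U * D₁))
    (hN : N₀ * D₀ + N₁ * D₁ = 1) (hK₀ : K₀ * D₀ = K) (hK₁ : K₁ * D₁ = K)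
    (hc₀ : K * D₀ = D₀ * K) (hc₁ : K * D₁ = D₁ * K) :
    ∃ κ : Matrix (Dbl n) (Dbl n) ℂ,
      S₂ * (U * K * V) * S₂⁻¹ * frameM X = frameM X * κ ∧
      S₁ * (U * K * V) * S₁⁻¹ * frameL X = frameL X * κ ∧
      (∃ Z, κ = Z * frameM X) ∧ ∃ Z, κ = Z * frameL X := by
  obtain ⟨hE, hF⟩ := eq_frame_mul X (E := S₂ * (U * D₀)) (F := S₁ * (U * D₁))
    (by simpa only [pairM, pairL, Matrix.mul_assoc] using hML)
  set T : Matrix (Dbl n) ι ℂ := fromRows (S₂ * (U * D₀)).toRows₁ (S₁ * (U * D₁)).toRows₂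
  have hE' : V * S₂⁻¹ * frameM X * T = D₀ := by
    rw [Matrix.mul_assoc, ← hE, Matrix.mul_assoc, ← Matrix.mul_assoc S₂⁻¹, hS₂, Matrix.one_mul,
      ← Matrix.mul_assoc, hVU, Matrix.one_mul]
  have hF' : V * S₁⁻¹ * frameL X * T = D₁ := by
    rw [Matrix.mul_assoc, ← hF, Matrix.mul_assoc, ← Matrix.mul_assoc S₁⁻¹, hS₁, Matrix.one_mul,
      ← Matrix.mul_assoc, hVU, Matrix.one_mul]
  set B : Matrix ι (Dbl n) ℂ := N₀ * (V * S₂⁻¹ * frameM X) + N₁ * (V * S₁⁻¹ * frameL X) with hB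
  have hBT : B * T = 1 := by
    rw [hB, Matrix.add_mul, Matrix.mul_assoc, hE', Matrix.mul_assoc, hF', hN]
  have hTB : T * B = 1 := (mul_eq_one_comm_of_equiv e.symm).mp hBT
  have key : ∀ S A : Matrix (Dbl n) (Dbl n) ℂ, ∀ D K' : Matrix ι ι ℂ, S⁻¹ * S = 1 →
      S * (U * D) = A * T → V * S⁻¹ * A * T = D → K' * D = K → K * D = D * K →
      S * (U * K * V) * S⁻¹ * A = A * (T * K * B) ∧ ∃ Z, T * K * B = Z * A := by
    intro S A D K' hS h1 h2 h3 h4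
    have hA : A = A * T * B := by rw [Matrix.mul_assoc, hTB, Matrix.mul_one]
    constructor
    · calc S * (U * K * V) * S⁻¹ * A = S * (U * K * V) * S⁻¹ * (A * T * B) := by rw [← hA]
        _ = S * (U * (K * (V * S⁻¹ * A * T))) * B := by simp only [Matrix.mul_assoc]
        _ = S * (U * D) * K * B := by rw [h2, h4]; simp only [Matrix.mul_assoc]
        _ = A * (T * K * B) := by rw [h1]; simp only [Matrix.mul_assoc]
    · refine ⟨T * K' * (V * S⁻¹), ?_⟩
      calc T * K * B = T * (K' * (V * S⁻¹ * A * T)) * B := by rw [h2, h3]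
        _ = T * K' * (V * S⁻¹) * (A * T * B) := by simp only [Matrix.mul_assoc]
        _ = _ := by rw [← hA]
  obtain ⟨a, b⟩ := key S₂ (frameM X) D₀ K₀ hS₂ hE hE' hK₀ hc₀
  obtain ⟨c, d⟩ := key S₁ (frameL X) D₁ K₁ hS₁ hF hF' hK₁ hc₁
  exact ⟨T * K * B, a, c, b, d⟩

/-- For admissible spectral data, both similarity transforms of `ℋ` are represented in the frames
by one and the same matrix `κ`, which moreover factors through each frame, hence vanishes on the
kernels of both. -/
lemma IsSpectralData.exists_generator {n m l : ℕ} {S₁ S₂ X : Matrix (Dbl n) (Dbl n) ℂ}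
    {U₁ : Matrix (Dbl n) (Dbl m) ℂ} {U₀ Uinf : Matrix (Dbl n) (Fin l) ℂ}
    {Shat Hhat : Matrix (Dbl m) (Dbl m) ℂ} (hS₁ : IsSymplectic S₁) (hS₂ : IsSymplectic S₂)
    (h : IsSpectralData (pairM S₂ X) (pairL S₁ X) U₁ U₀ Uinf Shat Hhat) :
    ∃ κ : Matrix (Dbl n) (Dbl n) ℂ,
      S₂ * hamiltonianOf U₁ U₀ Uinf Hhat * S₂⁻¹ * frameM X = frameM X * κ ∧
      S₁ * hamiltonianOf U₁ U₀ Uinf Hhat * S₁⁻¹ * frameL X = frameL X * κ ∧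
      (∃ Z, κ = Z * frameM X) ∧ ∃ Z, κ = Z * frameL X := by
  have hcomm : Hhat * Shat = Shat * Hhat := by
    rw [← h.exp_eq]; exact (Commute.refl Hhat).exp_right
  have e : Dbl n ≃ Dbl m ⊕ Dbl l := Fintype.equivOfCardEq (by
    have := h.size
    simp only [Fintype.card_sum, Fintype.card_fin]
    omega)
  have hVU : (bigJ m l)ᴴ * (bigU U₁ U₀ Uinf)ᴴ * J n * bigU U₁ U₀ Uinf = 1 := by
    rw [← bigJ_conjTranspose_mul, ← h.normalized]
    simp only [Matrix.mul_assoc]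
  have hS := h.symplectic.inv_mul
  have := exists_generator_of_intertwining e X S₁ S₂ hS₁.inv_mul hS₂.inv_mul (bigU U₁ U₀ Uinf)
    ((bigJ m l)ᴴ * (bigU U₁ U₀ Uinf)ᴴ * J n) hVU
    (D₀ := fromBlocks 1 0 0 (fromBlocks 1 0 0 0)) (D₁ := fromBlocks Shat 0 0 (fromBlocks 0 0 0 1))
    (K := fromBlocks Hhat 0 0 0) (N₀ := fromBlocks 1 0 0 (fromBlocks 1 0 0 0))
    (N₁ := fromBlocks 0 0 0 (fromBlocks 0 0 0 1)) (K₀ := fromBlocks Hhat 0 0 0)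
    (K₁ := fromBlocks (Hhat * Shat⁻¹) 0 0 0)
    (by
      simp only [bigU, fromCols_mul_fromBlocks, mul_fromCols, Matrix.mul_one, Matrix.mul_zero,
        add_zero, zero_add, fromCols_zero, h.zero_eig, h.infty_eig, h.finite_eig,
        Matrix.mul_assoc])
    (by
      simp [fromBlocks_multiply, fromBlocks_add, ← fromBlocks_one])
    (by simp [fromBlocks_multiply])
    (by simp [fromBlocks_multiply, Matrix.mul_assoc, hS])
    (by simp [fromBlocks_multiply])
    (by simp [fromBlocks_multiply, hcomm])
  simpa only [hamiltonianOf, Matrix.mul_assoc] using this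

end SPFlow

namespace SPFlow

open Matrix Filter NormedSpace

/-! ### Linear flows -/

lemma hasDerivAt_exp_smul_matrix {ι : Type*} [Fintype ι] [DecidableEq ι] (N : Matrix ι ι ℂ)
    (t : ℝ) : HasDerivAt (fun s : ℝ => exp (s • N)) (N * exp (t • N)) t :=
  hasDerivAt_exp_smul_const' (𝕂 := ℝ) N t

/-- If `R` intertwines `C` and `N`, the solution of `Y' = C Y` starting at `R E` is
`R exp (t N) E`. -/
lemma eq_mul_exp_mul_of_hasDerivAt {ι κ o : Type*} [Fintype ι] [DecidableEq ι] [Fintype κ]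
    [DecidableEq κ] [Fintype o] [DecidableEq o] {C : Matrix ι ι ℂ} {R : Matrix ι κ ℂ}
    {N : Matrix κ κ ℂ} (hCR : C * R = R * N) {Y : ℝ → Matrix ι o ℂ}
    (hY : ∀ t, HasDerivAt Y (C * Y t) t) {E : Matrix κ o ℂ} (h0 : Y 0 = R * E) (t : ℝ) :
    Y t = R * exp (t • N) * E := by
  have hexp (s : ℝ) : HasDerivAt (fun s : ℝ => R * exp (s • N) * E)
      (C * (R * exp (s • N) * E)) s := by
    let f : Matrix κ κ ℂ →ₗ[ℝ] Matrix ι o ℂ :=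
      { toFun := fun A => R * A * E
        map_add' := fun A B => by rw [Matrix.mul_add, Matrix.add_mul]
        map_smul' := fun c A => by simp }
    have := (f.toContinuousLinearMap.hasFDerivAt (x := exp (s • N))).comp_hasDerivAt s
      (hasDerivAt_exp_smul_matrix N s)
    have e : C * (R * exp (s • N) * E) = f (N * exp (s • N)) := by
      change _ = R * (N * exp (s • N)) * E
      simp only [← Matrix.mul_assoc, hCR]
    rw [e]
    exact this
  let g : Matrix ι o ℂ →ₗ[ℝ] Matrix ι o ℂ :=
    { toFun := fun A => C * A
      map_add' := fun A B => Matrix.mul_add _ _ _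
      map_smul' := fun c A => by simp }
  have := ODE_solution_unique_univ (v := fun _ A => C * A) (s := fun _ => Set.univ) (t₀ := 0)
    (K := ‖g.toContinuousLinearMap‖₊) (f := Y) (g := fun s => R * exp (s • N) * E)
    (fun _ => (g.toContinuousLinearMap.lipschitz).lipschitzOnWith)
    (fun t => ⟨hY t, trivial⟩) (fun t => ⟨hexp t, trivial⟩) (by simp [h0])
  exact congrFun this t

lemma exp_smul_submatrix {ι κ : Type*} [Fintype ι] [DecidableEq ι] [Fintype κ] [DecidableEq κ]
    (N : Matrix ι ι ℂ) (e : κ ≃ ι) (t : ℝ) :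
    exp (t • N.submatrix e e) = (exp (t • N)).submatrix e e :=
  (map_exp_of_mem_ball (𝕂 := ℂ) (reindexAlgEquiv ℂ ℂ e.symm)
    (continuous_id.matrix_submatrix _ _) (t • N)
    (by rw [expSeries_radius_eq_top]; exact edist_lt_top _ _)).symm

lemma analyticAt_exp_smul_apply {ι : Type*} [Fintype ι] [DecidableEq ι] (N : Matrix ι ι ℂ)
    (i j : ι) (t : ℝ) : AnalyticAt ℝ (fun s : ℝ => exp (s • N) i j) t := by
  let f : Matrix ι ι ℂ →ₗ[ℝ] ℂ :=
    { toFun := fun A => A i j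
      map_add' := fun _ _ => rfl
      map_smul' := fun _ _ => rfl }
  have h0 : AnalyticAt ℝ (fun s : ℝ => s • N) t := analyticAt_id.smul analyticAt_const
  have h1 : AnalyticAt ℝ (fun s : ℝ => exp (s • N)) t :=
    AnalyticAt.fun_comp (g := exp) (f := fun s : ℝ => s • N) (exp_analytic (𝕂 := ℝ) (t • N)) h0
  exact AnalyticAt.fun_comp (g := f.toContinuousLinearMap) (f.toContinuousLinearMap.analyticAt _) h1

lemma eventually_det_ne_zero {ι : Type*} [Fintype ι] [DecidableEq ι] {Q : ℝ → Matrix ι ι ℂ}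
    (hQ : ∀ i j t, AnalyticAt ℝ (fun s => Q s i j) t) {t₁ : ℝ} (h₁ : (Q t₁).det ≠ 0) (t₀ : ℝ) :
    ∀ᶠ t in 𝓝[≠] t₀, (Q t).det ≠ 0 := by
  have ha : AnalyticOnNhd ℝ (fun t => (Q t).det) Set.univ := by
    intro t _
    simp only [det_apply]
    refine Finset.analyticAt_fun_sum _ fun σ _ => ?_
    simp only [Units.smul_def, zsmul_eq_mul]
    exact analyticAt_const.mul (Finset.analyticAt_fun_prod _ fun i _ => hQ _ _ _)
  refine (ha t₀ trivial).eventually_eq_zero_or_eventually_ne_zero.resolve_left fun h => h₁ ?_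
  exact ha.eqOn_zero_of_preconnected_of_eventuallyEq_zero isPreconnected_univ
    (Set.mem_univ t₀) h (Set.mem_univ t₁)

lemma tendsto_norm_mulVec {ι o : Type*} [Fintype ι] [Fintype o] {A : ℝ → Matrix o ι ℂ} {t₀ : ℝ}
    (hA : ContinuousAt A t₀) (v : ι → ℂ) :
    Tendsto (fun t => ‖WithLp.toLp 2 (A t *ᵥ v)‖) (𝓝[≠] t₀)
      (𝓝 ‖WithLp.toLp 2 (A t₀ *ᵥ v)‖) := by
  refine Tendsto.mono_left ?_ nhdsWithin_le_nhds
  have hc : Continuous fun M : Matrix o ι ℂ => ‖WithLp.toLp 2 (M *ᵥ v)‖ :=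
    ((PiLp.continuous_toLp 2 _).comp (continuous_id.matrix_mulVec continuous_const)).norm
  exact hc.continuousAt.tendsto.comp hA

/-- `‖B Q⁻¹‖` blows up where `Q` becomes singular along a vector that `B` does not kill, because
`B v = (B Q⁻¹) (Q v)`. -/
lemma tendsto_norm_mul_inv_atTop {ι o : Type*} [Fintype ι] [DecidableEq ι] [Fintype o]
    [DecidableEq o] {Q : ℝ → Matrix ι ι ℂ} {B : ℝ → Matrix o ι ℂ} {t₀ : ℝ}
    (hQc : ContinuousAt Q t₀) (hBc : ContinuousAt B t₀)
    (hdet : ∀ᶠ t in 𝓝[≠] t₀, (Q t).det ≠ 0) {v : ι → ℂ} (hQv : Q t₀ *ᵥ v = 0)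
    (hBv : B t₀ *ᵥ v ≠ 0) :
    Tendsto (fun t => ‖B t * (Q t)⁻¹‖) (𝓝[≠] t₀) atTop := by
  have hv : v ≠ 0 := by rintro rfl; simp at hBv
  have hpos : 0 < ‖WithLp.toLp 2 (B t₀ *ᵥ v)‖ := by
    simpa using hBv
  have hQ0 : Tendsto (fun t => ‖WithLp.toLp 2 (Q t *ᵥ v)‖) (𝓝[≠] t₀) (𝓝[>] 0) := by
    rw [tendsto_nhdsWithin_iff]
    refine ⟨by simpa [hQv] using tendsto_norm_mulVec hQc v, ?_⟩
    filter_upwards [hdet] with t ht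
    have : Q t *ᵥ v ≠ 0 := fun h => hv (eq_zero_of_mulVec_eq_zero ht h)
    simpa using this
  refine tendsto_atTop_mono' _ ?_
    ((tendsto_norm_mulVec hBc v).pos_mul_atTop hpos hQ0.inv_tendsto_nhdsGT_zero)
  filter_upwards [hdet, hQ0 self_mem_nhdsWithin] with t ht hpos'
  have hu : IsUnit (Q t).det := isUnit_iff_ne_zero.mpr ht
  have hle := l2_opNorm_mulVec (B t * (Q t)⁻¹) (WithLp.toLp 2 (Q t *ᵥ v))
  simp only [mulVec_mulVec, Matrix.mul_assoc, nonsing_inv_mul _ hu, Matrix.mul_one] at hle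
  change _ * (_)⁻¹ ≤ _
  rw [mul_inv_le_iff₀ hpos']
  exact hle

/-- The complementary minor identity: for `N N' = 1`, the leading block of `N'` and the trailing
block of `N` have the same determinant up to the factor `det N`. -/
lemma det_mul_det_toBlocks₁₁ {ι o : Type*} [Fintype ι] [DecidableEq ι] [Fintype o] [DecidableEq o]
    {N N' : Matrix (ι ⊕ o) (ι ⊕ o) ℂ} (h : N * N' = 1) :
    N.det * N'.toBlocks₁₁.det = N.toBlocks₂₂.det := by
  have h' := h
  rw [← fromBlocks_toBlocks N, ← fromBlocks_toBlocks N', fromBlocks_multiply, ← fromBlocks_one,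
    fromBlocks_inj] at h'
  have e : N * fromBlocks N'.toBlocks₁₁ 0 N'.toBlocks₂₁ 1 =
      fromBlocks 1 N.toBlocks₁₂ 0 N.toBlocks₂₂ := by
    conv_lhs => rw [← fromBlocks_toBlocks N]
    rw [fromBlocks_multiply, h'.1, h'.2.2.1]
    simp
  simpa using congrArg det e

end SPFlow

namespace SPFlow

open Matrix Filter NormedSpace

/-! ### The Riccati systems in the frames -/

/-- The sign change `diag(I, -I)` turns the first linear system into the flow of `-G`. -/
lemma coeff_mul_frame {n : ℕ} {G X κ : Matrix (Dbl n) (Dbl n) ℂ} (hG : IsHamiltonian G)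
    (h : G * frameM X = frameM X * κ) :
    coeff G * fromBlocks 1 0 X.toBlocks₂₂ (-X.toBlocks₂₁) =
      fromBlocks 1 0 X.toBlocks₂₂ (-X.toBlocks₂₁) * -κ := by
  let Z : Matrix (Dbl n) (Dbl n) ℂ := fromBlocks 1 0 0 (-1)
  have hZZ : Z * Z = 1 := by simp [Z, fromBlocks_multiply]
  have hC : coeff G = -(Z * G * Z) := by
    conv_rhs => rw [← fromBlocks_toBlocks G]
    simp [coeff, Z, hG.toBlocks₁₁_conjTranspose, fromBlocks_multiply, fromBlocks_neg]
  have hR : fromBlocks 1 0 X.toBlocks₂₂ (-X.toBlocks₂₁) = Z * frameM X := by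
    simp [Z, frameM, fromBlocks_multiply]
  calc coeff G * fromBlocks 1 0 X.toBlocks₂₂ (-X.toBlocks₂₁)
      = -(Z * G * (Z * Z) * frameM X) := by
        rw [hC, hR]; simp only [neg_mul, Matrix.mul_assoc]
    _ = Z * frameM X * -κ := by
        rw [hZZ, Matrix.mul_one, Matrix.mul_assoc, h]; simp only [mul_neg, Matrix.mul_assoc]
    _ = _ := by rw [hR]

/-- Multiplication by `𝒥` turns the dual linear system into the flow of `G`. -/
lemma coeffStar_mul_frame {n : ℕ} {G X κ : Matrix (Dbl n) (Dbl n) ℂ} (hG : IsHamiltonian G)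
    (h : G * frameL X = frameL X * κ) :
    coeffStar G * fromBlocks 0 1 (-X.toBlocks₁₂) X.toBlocks₁₁ =
      fromBlocks 0 1 (-X.toBlocks₁₂) X.toBlocks₁₁ * κ := by
  have hC : coeffStar G = -(J n * G * J n) := by
    conv_rhs => rw [← fromBlocks_toBlocks G]
    simp [coeffStar, J, hG.toBlocks₁₁_conjTranspose, fromBlocks_multiply, fromBlocks_neg]
  have hR : fromBlocks 0 1 (-X.toBlocks₁₂) X.toBlocks₁₁ = J n * frameL X := by
    simp [J, frameL, fromBlocks_multiply]
  calc coeffStar G * fromBlocks 0 1 (-X.toBlocks₁₂) X.toBlocks₁₁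
      = -(J n * G * (J n * J n) * frameL X) := by
        rw [hC, hR]; simp only [neg_mul, Matrix.mul_assoc]
    _ = J n * frameL X * κ := by
        rw [J_mul_J, mul_neg, Matrix.mul_one, neg_mul, neg_neg, Matrix.mul_assoc, h,
          Matrix.mul_assoc]
    _ = _ := by rw [hR]

/-- In the frame coordinates, `Q` is the leading block of `exp (-tκ)`. -/
lemma IsLinearSolution.eq_toBlocks_exp {n : ℕ} {G X κ : Matrix (Dbl n) (Dbl n) ℂ}
    (hG : IsHamiltonian G) (h : G * frameM X = frameM X * κ)
    {Q P : ℝ → Matrix (Fin n) (Fin n) ℂ} (hQP : IsLinearSolution (coeff G) X.toBlocks₂₂ Q P)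
    (t : ℝ) : Q t = (exp (t • -κ)).toBlocks₁₁ ∧
      P t = X.toBlocks₂₂ * (exp (t • -κ)).toBlocks₁₁ -
        X.toBlocks₂₁ * (exp (t • -κ)).toBlocks₂₁ := by
  have := eq_mul_exp_mul_of_hasDerivAt (coeff_mul_frame hG h) hQP.ode
    (E := fromRows 1 0) (by rw [hQP.init, fromBlocks_mul_fromRows]; simp) t
  rw [← fromBlocks_toBlocks (exp (t • -κ)), fromBlocks_multiply, fromBlocks_mul_fromRows,
    fromRows_ext_iff] at this
  simpa [sub_eq_add_neg] using this

/-- In the frame coordinates, `Q⋆` is the trailing block of `exp (tκ)`. -/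
lemma IsLinearSolution.eq_toBlocks_exp_star {n : ℕ} {G X κ : Matrix (Dbl n) (Dbl n) ℂ}
    (hG : IsHamiltonian G) (h : G * frameL X = frameL X * κ)
    {Q P : ℝ → Matrix (Fin n) (Fin n) ℂ} (hQP : IsLinearSolution (coeffStar G) X.toBlocks₁₁ Q P)
    (t : ℝ) : Q t = (exp (t • κ)).toBlocks₂₂ ∧
      P t = X.toBlocks₁₁ * (exp (t • κ)).toBlocks₂₂ -
        X.toBlocks₁₂ * (exp (t • κ)).toBlocks₁₂ := by
  have := eq_mul_exp_mul_of_hasDerivAt (coeffStar_mul_frame hG h) hQP.ode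
    (E := fromRows 0 1) (by rw [hQP.init, fromBlocks_mul_fromRows]; simp) t
  rw [← fromBlocks_toBlocks (exp (t • κ)), fromBlocks_multiply, fromBlocks_mul_fromRows,
    fromRows_ext_iff] at this
  simpa [neg_add_eq_sub] using this

/-! ### Behaviour at a singular time -/

lemma exp_mulVec_eq_self {ι : Type*} [Fintype ι] [DecidableEq ι] {N : Matrix ι ι ℂ} {w : ι → ℂ}
    (h : N *ᵥ w = 0) : exp N *ᵥ w = w := by
  have h' : N * replicateCol Unit w = 0 := by
    rw [← replicateCol_mulVec, h, replicateCol_zero]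
  have := eq_mul_exp_mul_of_hasDerivAt (C := N) (R := 1) (N := N) (by simp)
    (Y := fun _ => replicateCol Unit w) (fun t => by rw [h']; exact hasDerivAt_const _ _)
    (E := replicateCol Unit w) (by simp) 1
  rw [one_smul, Matrix.one_mul, ← replicateCol_mulVec] at this
  exact (replicateCol_injective this).symm

/-- If `N` factors through `F` and the flow carries `w` into the kernel of `F`, then `w` is a fixed
point of the flow. -/
lemma exp_smul_mulVec_eq_self_of_mulVec_exp {ι : Type*} [Fintype ι] [DecidableEq ι]
    {N Z F : Matrix ι ι ℂ} (hN : N = Z * F) {w : ι → ℂ} {t : ℝ}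
    (h : F *ᵥ (exp (t • N) *ᵥ w) = 0) : exp (t • N) *ᵥ w = w := by
  have h1 : (t • N) *ᵥ (exp (t • N) *ᵥ w) = 0 := by
    conv_lhs => rw [smul_mulVec, hN, ← mulVec_mulVec, ← hN, h, mulVec_zero, smul_zero]
  have hu : IsUnit (exp (t • N)).det :=
    (isUnit_iff_isUnit_det (exp (t • N))).mp (Matrix.isUnit_exp (t • N))
  -- `exp (-tN)` fixes `exp (tN) w`, and carries it back to `w`.
  have h2 := exp_mulVec_eq_self (N := -(t • N)) (w := exp (t • N) *ᵥ w) (by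
    rw [neg_mulVec, h1, neg_zero])
  rw [mulVec_mulVec, Matrix.exp_neg, nonsing_inv_mul _ hu, one_mulVec] at h2
  exact h2.symm

/-- Blow-up for a family `exp (t N)` with first block column `[Q; E]`, where `P = C Q - D E`. At a
time where `Q v = 0` with `v ≠ 0`, neither `P v` nor `B v` vanishes: otherwise `exp (t N) (v, 0)`,
respectively `(v, 0)`, lies in the kernel of a frame through which `N` factors, so that the flow
fixes `(v, 0)` and `Q v = v`. -/
lemma blowup {ι : Type*} [Fintype ι] [DecidableEq ι] {N Z Z' : Matrix (ι ⊕ ι) (ι ⊕ ι) ℂ}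
    {B B' C D : Matrix ι ι ℂ} (hN : N = Z * fromBlocks 1 0 (-C) D)
    (hN' : N = Z' * fromBlocks B B' 0 1) {Q P : ℝ → Matrix ι ι ℂ}
    (hQ : ∀ t, Q t = (exp (t • N)).toBlocks₁₁)
    (hP : ∀ t, P t = C * (exp (t • N)).toBlocks₁₁ - D * (exp (t • N)).toBlocks₂₁)
    {t₀ : ℝ} (h₀ : (Q t₀).det = 0) :
    Tendsto (fun t => ‖P t * (Q t)⁻¹‖) (𝓝[≠] t₀) atTop ∧
      Tendsto (fun t => ‖B * (Q t)⁻¹‖) (𝓝[≠] t₀) atTop := by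
  have hexp : Continuous fun t : ℝ => exp (t • N) := continuous_iff_continuousAt.mpr
    fun t => (hasDerivAt_exp_smul_matrix N t).continuousAt
  have hQc : Continuous Q := by
    rw [funext hQ]; exact hexp.matrix_submatrix _ _
  have hPc : Continuous P := by
    rw [funext hP]
    exact (continuous_const.matrix_mul (hexp.matrix_submatrix _ _)).sub
      (continuous_const.matrix_mul (hexp.matrix_submatrix _ _))
  have hdet : ∀ᶠ t in 𝓝[≠] t₀, (Q t).det ≠ 0 := by
    refine eventually_det_ne_zero (t₁ := 0) (fun i j t => ?_) ?_ t₀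
    · simp only [hQ]
      exact analyticAt_exp_smul_apply N _ _ t
    · rw [hQ, zero_smul, exp_zero, ← fromBlocks_one, toBlocks_fromBlocks₁₁, det_one]
      exact one_ne_zero
  obtain ⟨v, hv, hQv⟩ := exists_mulVec_eq_zero_iff.mpr h₀
  have hblock (t : ℝ) : exp (t • N) *ᵥ Sum.elim v 0 =
      Sum.elim (Q t *ᵥ v) ((exp (t • N)).toBlocks₂₁ *ᵥ v) := by
    rw [← fromBlocks_toBlocks (exp (t • N)), fromBlocks_mulVec, hQ]
    simp
  -- If the flow fixed `(v, 0)`, then `Q t₀ v = v`.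
  have hne : exp (t₀ • N) *ᵥ Sum.elim v 0 ≠ Sum.elim v 0 := by
    intro h
    rw [hblock, hQv] at h
    exact hv (funext fun i => (congrFun h (Sum.inl i)).symm)
  constructor
  · refine tendsto_norm_mul_inv_atTop hQc.continuousAt hPc.continuousAt hdet hQv fun h => hne ?_
    refine exp_smul_mulVec_eq_self_of_mulVec_exp hN ?_
    rw [hP, ← hQ, sub_mulVec, ← mulVec_mulVec, hQv, mulVec_zero, zero_sub, neg_eq_zero,
      ← mulVec_mulVec] at h
    rw [hblock, hQv, fromBlocks_mulVec]
    simp [h]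
  · refine tendsto_norm_mul_inv_atTop hQc.continuousAt continuousAt_const hdet hQv fun h => hne ?_
    refine exp_mulVec_eq_self ?_
    rw [smul_mulVec, hN', ← mulVec_mulVec, fromBlocks_mulVec]
    simp [h]

end SPFlow

theorem theorem3p10 (n m l : ℕ)
    (S₁ S₂ X₁ : Matrix (SPFlow.Dbl n) (SPFlow.Dbl n) ℂ)
    (hS₁ : SPFlow.IsSymplectic S₁) (hS₂ : SPFlow.IsSymplectic S₂) (hX₁ : X₁.IsHermitian)
    (hreg : SPFlow.IsRegularPair (SPFlow.pairM S₂ X₁) (SPFlow.pairL S₁ X₁))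
    (hind : SPFlow.IndexAtInftyLE (SPFlow.pairM S₂ X₁) (SPFlow.pairL S₁ X₁) 1)
    (U₁ : Matrix (SPFlow.Dbl n) (SPFlow.Dbl m) ℂ)
    (U₀ Uinf : Matrix (SPFlow.Dbl n) (Fin l) ℂ)
    (Shat Hhat : Matrix (SPFlow.Dbl m) (SPFlow.Dbl m) ℂ)
    (hdata : SPFlow.IsSpectralData (SPFlow.pairM S₂ X₁) (SPFlow.pairL S₁ X₁) U₁ U₀ Uinf Shat Hhat)
    (Q P Qs Ps : ℝ → Matrix (Fin n) (Fin n) ℂ)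
    (hQP : SPFlow.IsLinearSolution
      (SPFlow.coeff (S₂ * SPFlow.hamiltonianOf U₁ U₀ Uinf Hhat * S₂⁻¹)) X₁.toBlocks₂₂ Q P)
    (hQPs : SPFlow.IsLinearSolution
      (SPFlow.coeffStar (S₁ * SPFlow.hamiltonianOf U₁ U₀ Uinf Hhat * S₁⁻¹)) X₁.toBlocks₁₁ Qs Ps) :
    {t : ℝ | (Q t).det ≠ 0} = {t : ℝ | (Qs t).det ≠ 0} ∧
    ∀ t₀ : ℝ, (Q t₀).det = 0 →
      Filter.Tendsto (fun t : ℝ => ‖P t * (Q t)⁻¹‖) (𝓝[≠] t₀) Filter.atTop ∧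
      Filter.Tendsto (fun t : ℝ => ‖X₁.toBlocks₁₂ * (Q t)⁻¹‖) (𝓝[≠] t₀) Filter.atTop ∧
      Filter.Tendsto (fun t : ℝ => ‖Ps t * (Qs t)⁻¹‖) (𝓝[≠] t₀) Filter.atTop ∧
      Filter.Tendsto (fun t : ℝ => ‖X₁.toBlocks₂₁ * (Qs t)⁻¹‖) (𝓝[≠] t₀) Filter.atTop := by
  obtain ⟨κ, hκ₂, hκ₁, ⟨Z₂, hZ₂⟩, ⟨Z₁, hZ₁⟩⟩ := hdata.exists_generator hS₁ hS₂
  have hH := SPFlow.isHamiltonian_hamiltonianOf U₁ U₀ Uinf hdata.hamiltonian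
  have hQ := fun t => hQP.eq_toBlocks_exp (hH.conj hS₂) hκ₂ t
  have hQs := fun t => hQPs.eq_toBlocks_exp_star (hH.conj hS₁) hκ₁ t
  have hdet (t : ℝ) : (Q t).det = 0 ↔ (Qs t).det = 0 := by
    have hu : IsUnit (NormedSpace.exp (t • κ)) := Matrix.isUnit_exp _
    have hu' := (Matrix.isUnit_iff_isUnit_det _).mp hu
    have h1 : NormedSpace.exp (t • κ) * NormedSpace.exp (t • -κ) = 1 := by
      rw [smul_neg, Matrix.exp_neg, Matrix.mul_nonsing_inv _ hu']
    rw [(hQ t).1, (hQs t).1, ← SPFlow.det_mul_det_toBlocks₁₁ h1, mul_eq_zero,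
      or_iff_right hu'.ne_zero]
  refine ⟨Set.ext fun t => not_congr (hdet t), fun t₀ h₀ => ?_⟩
  obtain ⟨hP, hB⟩ := SPFlow.blowup (N := -κ) (Z := -Z₂) (Z' := -Z₁)
    (by rw [neg_mul]; exact congrArg _ hZ₂) (by rw [neg_mul]; exact congrArg _ hZ₁)
    (fun t => (hQ t).1) (fun t => (hQ t).2) h₀
  -- Exchanging the two halves of the indices turns the trailing block of `exp (tκ)` into the
  -- leading one and exchanges the roles of the two frames.
  let e : SPFlow.Dbl n ≃ SPFlow.Dbl n := Equiv.sumComm _ _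
  obtain ⟨hPs, hBs⟩ := SPFlow.blowup (N := κ.submatrix e e) (Z := Z₁.submatrix e e)
    (Z' := Z₂.submatrix e e) (C := X₁.toBlocks₁₁) (D := X₁.toBlocks₁₂) (B := X₁.toBlocks₂₁)
    (B' := -X₁.toBlocks₂₂) (Q := Qs) (P := Ps)
    (by
      rw [hZ₁, ← Matrix.submatrix_mul_equiv _ _ _ e]
      exact congrArg _ (Matrix.fromBlocks_submatrix_sum_swap_sum_swap _ _ _ _))
    (by
      rw [hZ₂, ← Matrix.submatrix_mul_equiv _ _ _ e]
      exact congrArg _ (Matrix.fromBlocks_submatrix_sum_swap_sum_swap _ _ _ _))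
    (fun t => by rw [SPFlow.exp_smul_submatrix]; exact (hQs t).1)
    (fun t => by rw [SPFlow.exp_smul_submatrix]; exact (hQs t).2)
    ((hdet t₀).mp h₀)
  exact ⟨hP, hB, hPs, hBs⟩
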